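/- Let $L$ be an even positive integer, $\beta=L^2$, and $1\le m\le M$. Let $\mu$ be Haar probability measure on the unit circle $\mathbb T\subset\mathbb C$, and consider the circular $\beta$-ensemble of $M$ particles, that is, the point process on $\mathbb T$ whose joint density with respect to $\mu^M$ is \[ f(x_1,\dots,x_M)=\frac1{M!\,Z}\prod_{j<k}^{M}|x_k-x_j|^\beta,\qquad Z=\frac1{M!}\int_{\mathbb T^M}\prod_{j<k}^{M}|x_k-x_j|^\beta\,d\mu^M(\mathbf x). \] Its $m$th correlation function $R_m:\mathbb T^m\to[0,\infty)$ is characterized, up to $\mu^m$-null sets, by $\mathbb E[N_{B_1}\cdots N_{B_m}]=\int_{B_1\times\cdots\times B_m}R_m\,d\mu^m$ for all pairwise disjoint Borel sets $B_1,\dots,B_m\subset\mathbb T$, where $N_B$ is the number of particles in $B$; it is represented by the function \[ R_m(\mathbf y)=\frac{M!}{(M-m)!}\int_{\mathbb T^{M-m}}f(y_1,\dots,y_m,x_1,\dots,x_{M-m})\,d\mu^{M-m}(\mathbf x). \] Put $M'=M-m$ and $N'=LM'$, and let $\mathbf e_0,\dots,\mathbf e_{N'-1}$ be the standard basis of $V'=\mathbb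 C^{N'}$. For an $L$-element subset $\mathfrak u=\{\mathfrak u(1)<\cdots<\mathfrak u(L)\}$ of $\{0,\dots,N'-1\}$ put \[ \mathbf e_{\mathfrak u}=\mathbf e_{\mathfrak u(1)}\wedge\cdots\wedge\mathbf e_{\mathfrak u(L)},\qquad \delta\mathfrak u=\sum_{k=1}^L\mathfrak u(k)-\frac{L(N'-1)}2,\qquad \widetilde\Delta\mathfrak u=\prod_{j<k}^{L}\frac{\mathfrak u(k)-\mathfrak u(j)}{k-j}. \] For $\omega\in\Lambda^LV'$ let the hyperpfaffian $\mathrm{PF}\,\omega$ be the coefficient of $\mathbf e_0\wedge\cdots\wedge\mathbf e_{N'-1}$ in $\omega^{\wedge M'}/M'!$, and let $[\ell(x)]_{(j)}$ denote the coefficient of $x^j$ in a Laurent polynomial $\ell(x)$. Then for every $\mathbf y=(y_1,\dots,y_m)\in\mathbb T^m$, \[ R_m(\mathbf y)=M!\binom{\beta M/2}{\beta/2,\dots,\beta/2}^{-1}\prod_{j<k}^m|y_k-y_j|^\beta\cdot\prod_{n=1}^m y_n^{-\beta(M-m)/2}\cdot\mathrm{PF}\,\gamma_{\mathbf y}, \]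 where $\gamma_{\mathbf y}\in\Lambda^LV'$ is the $L$-vector \[ \gamma_{\mathbf y}=\sum_{|\delta\mathfrak u|\le\beta m/2}\Big[x^{-\beta m/2}\prod_{j=1}^m(x-y_j)^\beta\Big]_{(\delta\mathfrak u)}\widetilde\Delta\mathfrak u\;\mathbf e_{\mathfrak u}, \] the sum being over all $L$-element subsets $\mathfrak u$ of $\{0,\dots,N'-1\}$ with $|\delta\mathfrak u|\le\beta m/2$. -/

import Mathlib

noncomputable section

namespace HyperPf

open MeasureTheory

/-! ### Point processes and correlation functions -/

open Classical in
/-- `N_B(x)`: the number of coordinates of the configuration `x` lying in `B`. -/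
def occupation {W : Type*} {M : ℕ} (B : Set W) (x : Fin M → W) : ℕ :=
  (Finset.univ.filter fun i => x i ∈ B).card

/-- `R : W^m → [0, ∞)` is an `m`-th correlation function (with respect to `μ`) of the `M`-particle
point process with joint law `P`: for pairwise disjoint measurable `B₁, …, B_m`,
`E[N_{B₁} ⋯ N_{B_m}] = ∫_{B₁ × ⋯ × B_m} R dμ^m`. -/
structure IsCorrelationFunction {W : Type*} [MeasurableSpace W] (μ : Measure W) {M : ℕ}
    (P : Measure (Fin M → W)) (m : ℕ) (R : (Fin m → W) → ℝ) : Prop where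
  measurable : Measurable R
  nonneg : ∀ y, 0 ≤ R y
  expectation_eq : ∀ B : Fin m → Set W, (∀ k, MeasurableSet (B k)) →
    (Pairwise fun j k => Disjoint (B j) (B k)) →
    ∫⁻ x, ∏ k, (occupation (B k) x : ENNReal) ∂P =
      ∫⁻ y in Set.univ.pi B, ENNReal.ofReal (R y) ∂(Measure.pi fun _ => μ)

/-! ### The circular `β`-ensemble -/

instance : MeasurableSpace Circle := borel Circle

instance : BorelSpace Circle := ⟨rfl⟩

/-- Haar probability measure on the unit circle. -/
def haarCircle : Measure Circle := Measure.haarMeasure ⊤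

/-- `∏_{j < k} |x_k - x_j|^β`. -/
def absVandermonde (β : ℕ) {n : ℕ} (x : Fin n → Circle) : ℝ :=
  ∏ k, ∏ j ∈ Finset.Iio k, ‖(x k : ℂ) - (x j : ℂ)‖ ^ β

/-- The partition function `Z = (1 / M!) ∫ ∏_{j < k} |x_k - x_j|^β dμ^M`. -/
def partitionFunction (β M : ℕ) : ℝ :=
  1 / (M.factorial : ℝ) *
    ∫ x : Fin M → Circle, absVandermonde β x ∂(Measure.pi fun _ => haarCircle)

/-- The joint density of the `M` particles with respect to `μ^M`. -/
def jointDensity (β M : ℕ) (x : Fin M → Circle) : ℝ :=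
  1 / ((M.factorial : ℝ) * partitionFunction β M) * absVandermonde β x

/-- The joint law of the `M` particles. -/
def circularEnsemble (β M : ℕ) : Measure (Fin M → Circle) :=
  (Measure.pi fun _ => haarCircle).withDensity fun x => ENNReal.ofReal (jointDensity β M x)

/-- The version of the `m`-th correlation function given by the marginal density:
`R_m(y) = M! / (M - m)! ∫ f(y₁, …, y_m, x₁, …, x_{M-m}) dμ^{M-m}(x)`. -/
def correlation (β : ℕ) {m M : ℕ} (hm : m ≤ M) (y : Fin m → Circle) : ℝ :=
  (M.factorial : ℝ) / ((M - m).factorial : ℝ) *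
    ∫ x : Fin (M - m) → Circle,
      jointDensity β M (fun i => Fin.append y x (Fin.cast (Nat.add_sub_of_le hm).symm i))
      ∂(Measure.pi fun _ => haarCircle)

/-! ### Hyperpfaffians -/

/-- The coefficient of the volume form `e_0 ∧ ⋯ ∧ e_{N-1}`; on the determinantal line this is
the Hodge star. -/
def hodgeStarTop (N : ℕ) (ω : ExteriorAlgebra ℂ (Fin N → ℂ)) : ℂ :=
  (Pi.basisFun ℂ (Fin N)).ExteriorAlgebra.coord Finset.univ ω

/-- The hyperpfaffian `PF ω = ⋆ (ω^{∧ K} / K!)` of an `L`-vector `ω` over `ℂ^{LK}`. -/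
def hyperpfaffian (L K : ℕ) (ω : ⋀[ℂ]^L (Fin (L * K) → ℂ)) : ℂ :=
  hodgeStarTop (L * K) ((K.factorial : ℂ)⁻¹ • (ω : ExteriorAlgebra ℂ (Fin (L * K) → ℂ)) ^ K)

/-- The basis `L`-vector `e_u = e_{u(1)} ∧ ⋯ ∧ e_{u(L)}`, `u(1) < ⋯ < u(L)`. -/
def basisVec {L N : ℕ} (u : Set.powersetCard (Fin N) L) : ⋀[ℂ]^L (Fin N → ℂ) :=
  exteriorPower.ιMulti_family ℂ L (Pi.basisFun ℂ (Fin N)) u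

/-- The `k`-th smallest element of `u` (with `k` starting at `0`). -/
def elt {L N : ℕ} (u : Set.powersetCard (Fin N) L) (k : Fin L) : ℕ :=
  (Finset.orderEmbOfFin u.1 u.2 k : Fin N)

/-- `δu = Σu - L (N - 1) / 2`; the division is exact when `L` is even. -/
def delta {L N : ℕ} (u : Set.powersetCard (Fin N) L) : ℤ :=
  (∑ k, (elt u k : ℤ)) - (L : ℤ) * ((N : ℤ) - 1) / 2

/-- `∏_{j < k} (u(k) - u(j)) / (k - j)`. -/
def vdm {L N : ℕ} (u : Set.powersetCard (Fin N) L) : ℂ :=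
  ∏ k : Fin L, ∏ j ∈ Finset.Iio k, ((elt u k : ℂ) - (elt u j : ℂ)) / (((k : ℕ) : ℂ) - ((j : ℕ) : ℂ))

open LaurentPolynomial in
/-- The Laurent polynomial `x^{-β m / 2} ∏_j (x - y_j)^β` (for `β` even). -/
def laurent (β : ℕ) {m : ℕ} (y : Fin m → Circle) : LaurentPolynomial ℂ :=
  T (-((β * m / 2 : ℕ) : ℤ)) * ∏ j, (T 1 - C (y j : ℂ)) ^ β

/-- The `L`-vector `γ_y` over `ℂ^{LK}`, for `β = L²`. -/
def gammaVec (L K : ℕ) {m : ℕ} (y : Fin m → Circle) : ⋀[ℂ]^L (Fin (L * K) → ℂ) :=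
  ∑ u : Set.powersetCard (Fin (L * K)) L with |delta u| ≤ ((L ^ 2 * m / 2 : ℕ) : ℤ),
    ((laurent (L ^ 2) y).coeff (delta u) * vdm u) • basisVec u

end HyperPf

end

/-!
Two facts about `|Δ(x)|^{L²} = ∏_{j < k} |x_k - x_j|^{L²}` on the torus `𝕋^K` drive the formula.

* Its total mass is the constant term of Dyson's product `∏_{i ≠ j} (1 - x_i / x_j)^{β/2}`.
  Lagrange interpolation of the constant `1` gives `1 = ∑_i ∏_{j ≠ i} (1 - x_i / x_j)⁻¹`, hence a
  recurrence in the exponents that multinomial coefficients also satisfy (Good's argument). This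
  evaluates the partition function.
* Up to a power of the `x_k` it is the determinant of a confluent Vandermonde matrix with nodes
  `x_k⁻¹`, each of multiplicity `L`, that is, the top coefficient of a wedge product of `K`
  osculating `L`-vectors, one for each particle. The coefficient of `e_u` in an osculating
  `L`-vector is a monomial times a determinant of binomial coefficients, which is the Vandermonde
  quotient of `u`.

For even `L` the `L`-vectors commute, and Fubini turns the integral over `𝕋^K` of a wedge product of
one-particle `L`-vectors into the `K`-th power of the integral of one of them, as in de Bruijn's
identity. The fixed particles `y` weight each `L`-vector by `∏_j |x - y_j|^β`, a Laurent polynomial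
in `x`, and integration over the circle extracts its coefficient of degree `δu`.

The marginal density is a correlation function because the joint law is exchangeable: on disjoint
sets `B_k` the product of the occupation numbers counts the injections `σ` with `x_{σ(k)} ∈ B_k`,
and all injections contribute equally. It is the only one up to null sets because almost every
configuration has distinct points, hence lies in one of countably many boxes with disjoint sides.
-/

noncomputable section

namespace HyperPf

open MeasureTheory

/-! ### Determinants -/

theorem prod_Iio_comm_prod_Ioi {ι R : Type*} [Fintype ι] [Preorder ι] [LocallyFiniteOrderBot ι]
    [LocallyFiniteOrderTop ι] [CommMonoid R] (f : ι → ι → R) :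
    ∏ k, ∏ j ∈ Finset.Iio k, f j k = ∏ j, ∏ k ∈ Finset.Ioi j, f j k :=
  Finset.prod_comm' (by simp)

theorem prod_factorial_mul_det_choose {R : Type*} [CommRing R] [IsDomain R] {n : ℕ}
    (v : Fin n → ℕ) :
    (∏ i : Fin n, ((i : ℕ).factorial : R)) *
        (Matrix.of fun i j : Fin n => ((v i).choose j : R)).det =
      ∏ k, ∏ j ∈ Finset.Iio k, ((v k : R) - (v j : R)) := by
  rw [prod_Iio_comm_prod_Ioi fun j k => (v k : R) - (v j : R),
    ← Matrix.det_vandermonde (fun i => (v i : R)),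
    Matrix.det_eval_matrixOfPolynomials_eq_det_vandermonde (fun i => (v i : R))
      (fun i => descPochhammer R i) (fun i => descPochhammer_natDegree R i)
      (fun i => monic_descPochhammer R i), ← Matrix.det_mul_row]
  congr 1
  ext i j
  simp [descPochhammer_eval_eq_descFactorial, Nat.descFactorial_eq_factorial_mul_choose]

theorem prod_prod_Iio_natCast_sub {R : Type*} [CommRing R] [IsDomain R] (n : ℕ) :
    ∏ k : Fin n, ∏ j ∈ Finset.Iio k, (((k : ℕ) : R) - ((j : ℕ) : R)) =
      ∏ i : Fin n, ((i : ℕ).factorial : R) := by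
  rw [← prod_factorial_mul_det_choose (R := R) fun i : Fin n => (i : ℕ),
    Matrix.det_of_isLowerTriangular]
  · simp
  · intro i j hij
    have hlt : (i : ℕ) < j := by simpa using hij
    simp [Nat.choose_eq_zero_of_lt hlt]

theorem det_choose {K : Type*} [Field K] [CharZero K] {n : ℕ} (v : Fin n → ℕ) :
    (Matrix.of fun i j : Fin n => ((v i).choose j : K)).det =
      ∏ k, ∏ j ∈ Finset.Iio k,
        ((v k : K) - (v j : K)) / (((k : ℕ) : K) - ((j : ℕ) : K)) := by
  have hfactorial : ∏ i : Fin n, ((i : ℕ).factorial : K) ≠ 0 :=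
    Finset.prod_ne_zero_iff.2 fun i _ => Nat.cast_ne_zero.2 (Nat.factorial_ne_zero _)
  simp only [Finset.prod_div_distrib]
  rw [← prod_factorial_mul_det_choose, prod_prod_Iio_natCast_sub,
    mul_div_cancel_left₀ _ hfactorial]

section Confluent

open Polynomial

variable {R : Type*}

/-- The vector of the `l`-th divided derivatives at `x` of the monomials `1, X, …, X^{N-1}`, so
that for `l = 0, 1, …` these vectors span the osculating flag of the moment curve. -/
def osculatingVec [CommSemiring R] (N l : ℕ) (x : R) : Fin N → R :=
  fun n => ((n : ℕ).choose l : R) * x ^ ((n : ℕ) - l)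

theorem osculatingVec_dotProduct_coeff [CommRing R] {N : ℕ} {p : R[X]} (hp : p.natDegree < N)
    (l : ℕ) (x : R) :
    osculatingVec N l x ⬝ᵥ (fun n : Fin N => p.coeff n) = (taylor x p).coeff l := by
  rw [taylor_coeff, hasseDeriv_apply, sum_over_range' _ (by simp) N hp, eval_finsetSum,
    ← Fin.sum_univ_eq_sum_range
      fun n => (monomial (n - l) ((n.choose l : R) * p.coeff n)).eval x]
  refine Finset.sum_congr rfl fun n _ => ?_
  rw [osculatingVec, eval_monomial]
  ring

variable [CommRing R] (L : ℕ) (x : ℕ → R)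

/-- The monic polynomial `∏_{k < i / L} (X - x_k)^L · (X - x_{i / L})^{i % L}` of degree `i`: the
Newton basis for Hermite interpolation at the nodes `x_0, x_1, …`, each repeated `L` times. -/
def newtonPoly (i : ℕ) : R[X] :=
  (∏ k ∈ Finset.range (i / L), (X - C (x k)) ^ L) * (X - C (x (i / L))) ^ (i % L)

theorem monic_newtonPoly (i : ℕ) : (newtonPoly L x i).Monic :=
  (monic_prod_of_monic _ _ fun k _ => (monic_X_sub_C (x k)).pow L).mul ((monic_X_sub_C _).pow _)

theorem natDegree_newtonPoly [Nontrivial R] (i : ℕ) : (newtonPoly L x i).natDegree = i := by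
  have hmonic (k : ℕ) : ((X - C (x k)) ^ L).Monic := (monic_X_sub_C (x k)).pow L
  rw [newtonPoly, (monic_prod_of_monic _ _ fun k _ => hmonic k).natDegree_mul
    ((monic_X_sub_C _).pow _), natDegree_prod_of_monic _ _ fun k _ => hmonic k]
  simp only [(monic_X_sub_C _).natDegree_pow, natDegree_X_sub_C, Finset.sum_const,
    Finset.card_range, smul_eq_mul, mul_one]
  exact Nat.div_add_mod' i L

theorem taylor_X_sub_C_pow_mul (r : R) (n : ℕ) (p : R[X]) :
    taylor r ((X - C r) ^ n * p) = X ^ n * taylor r p := by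
  simp [taylor_mul]

theorem coeff_taylor_newtonPoly_of_lt (hL : 0 < L) {i j : ℕ} (hij : i < j) :
    (taylor (x (i / L)) (newtonPoly L x j)).coeff (i % L) = 0 := by
  rcases (Nat.div_le_div_right hij.le : i / L ≤ j / L).lt_or_eq with hdiv | hdiv
  · rw [newtonPoly, ← Finset.mul_prod_erase _ _ (Finset.mem_range.2 hdiv), mul_assoc,
      taylor_X_sub_C_pow_mul, coeff_X_pow_mul', if_neg (Nat.mod_lt _ hL).not_ge]
  · have hmod : i % L < j % L := by
      have hi := Nat.div_add_mod i L
      have hj := Nat.div_add_mod j L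
      rw [hdiv] at hi
      lia
    rw [newtonPoly, hdiv, mul_comm, taylor_X_sub_C_pow_mul, coeff_X_pow_mul',
      if_neg hmod.not_ge]

theorem coeff_taylor_newtonPoly_self (i : ℕ) :
    (taylor (x (i / L)) (newtonPoly L x i)).coeff (i % L) =
      ∏ k ∈ Finset.range (i / L), (x (i / L) - x k) ^ L := by
  rw [newtonPoly, mul_comm, taylor_X_sub_C_pow_mul, coeff_X_pow_mul', if_pos le_rfl]
  simp [taylor_coeff_zero, eval_prod]

theorem prod_range_mul_div {A : Type*} [CommMonoid A] (hL : 0 < L) (d : ℕ → A) (K : ℕ) :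
    ∏ i ∈ Finset.range (L * K), d (i / L) = ∏ k ∈ Finset.range K, d k ^ L := by
  induction K with
  | zero => simp
  | succ K ih =>
    have hblock : ∀ i ∈ Finset.range L, d ((L * K + i) / L) = d K := fun i hi => by
      rw [Nat.mul_add_div hL, Nat.div_eq_of_lt (Finset.mem_range.1 hi), add_zero]
    rw [Nat.mul_succ, Finset.prod_range_add, ih, Finset.prod_range_succ,
      Finset.prod_congr rfl hblock, Finset.prod_const, Finset.card_range]

theorem osculatingVec_mul_coeff_newtonPoly [Nontrivial R] (N : ℕ) :
    (Matrix.of fun i : Fin N => osculatingVec N (i % L) (x (i / L))) *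
        (Matrix.of fun i j : Fin N => (newtonPoly L x j).coeff i) =
      Matrix.of fun i j : Fin N =>
        (taylor (x (i / L)) (newtonPoly L x j)).coeff (i % L) := by
  ext i j
  exact osculatingVec_dotProduct_coeff ((natDegree_newtonPoly L x j).trans_lt j.2) _ _

/-- The confluent Vandermonde determinant: multiplying by the unitriangular matrix of coefficients
of the Newton basis makes the matrix of osculating vectors triangular. -/
theorem det_osculatingVec_eq_prod_sub_pow (hL : 0 < L) (K : ℕ) :
    (Matrix.of fun i : Fin (L * K) => osculatingVec (L * K) (i % L) (x (i / L))).det =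
      ∏ k ∈ Finset.range K, ∏ j ∈ Finset.range k, (x k - x j) ^ (L ^ 2) := by
  nontriviality R
  have hdet := congrArg Matrix.det (osculatingVec_mul_coeff_newtonPoly L x (L * K))
  rw [Matrix.det_mul, Matrix.det_matrixOfPolynomials (fun j : Fin (L * K) => newtonPoly L x j)
    (fun i => natDegree_newtonPoly L x i) (fun i => monic_newtonPoly L x i), mul_one] at hdet
  rw [hdet, Matrix.det_of_isLowerTriangular]
  · simp only [Matrix.of_apply, coeff_taylor_newtonPoly_self]
    rw [Fin.prod_univ_eq_prod_range
      (fun i => ∏ k ∈ Finset.range (i / L), (x (i / L) - x k) ^ L),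
      prod_range_mul_div L hL (fun q => ∏ k ∈ Finset.range q, (x q - x k) ^ L)]
    simp only [← Finset.prod_pow, ← pow_mul, sq]
  · intro i j hij
    exact coeff_taylor_newtonPoly_of_lt L x hL (by simpa using hij)

end Confluent

/-! ### Exterior products -/

theorem ιMulti_eq_basis_univ {R V : Type*} [CommRing R] [AddCommGroup V] [Module R V] {N : ℕ}
    (b : Module.Basis (Fin N) R V) :
    ExteriorAlgebra.ιMulti R N b = b.ExteriorAlgebra Finset.univ := by
  have hid : (Finset.univ : Finset (Fin N)).orderEmbOfFin (by simp) =
      (OrderIso.refl (Fin N)).toOrderEmbedding :=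
    (Finset.orderEmbOfFin_unique' _ fun i => Finset.mem_univ _).symm
  rw [ExteriorAlgebra.basis_apply_ofCard b (n := N) (by simp), ExteriorAlgebra.ιMulti_family]
  congr 1
  ext1 i
  rw [Function.comp_apply, Set.powersetCard.ofFinEmbEquiv_symm_apply]
  exact congrArg b (DFunLike.congr_fun hid i).symm

theorem hodgeStarTop_ιMulti {N : ℕ} (v : Fin N → Fin N → ℂ) :
    hodgeStarTop N (ExteriorAlgebra.ιMulti ℂ N v) = (Matrix.of v).det := by
  set b := Pi.basisFun ℂ (Fin N)
  have hdet := DFunLike.congr_fun (AlternatingMap.eq_smul_basis_det b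
    ((b.ExteriorAlgebra.coord Finset.univ).compAlternatingMap (ExteriorAlgebra.ιMulti ℂ N))) v
  simp only [LinearMap.compAlternatingMap_apply, ιMulti_eq_basis_univ b, Module.Basis.coord_apply,
    Module.Basis.repr_self, Finsupp.single_eq_same, one_smul] at hdet
  rw [hodgeStarTop, Module.Basis.coord_apply, hdet, Module.Basis.det_apply,
    ← Matrix.det_transpose]
  rfl

theorem prod_ofFn_ιMulti {R V : Type*} [CommRing R] [AddCommGroup V] [Module R V] (L K : ℕ)
    (w : ℕ → V) :
    (List.ofFn fun k : Fin K =>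
        ExteriorAlgebra.ιMulti R L fun l : Fin L => w (L * k + l)).prod =
      ExteriorAlgebra.ιMulti R (L * K) fun i => w i := by
  simp only [ExteriorAlgebra.ιMulti_apply]
  rw [List.ofFn_mul', List.prod_flatten, List.map_ofFn]
  rfl

theorem ιMulti_eq_sum_det {L N : ℕ} (v : Fin L → Fin N → ℂ) :
    exteriorPower.ιMulti ℂ L v =
      ∑ u : Set.powersetCard (Fin N) L,
        (Matrix.of fun i j => v i (Finset.orderEmbOfFin u.1 u.2 j)).det • basisVec u := by
  rw [← ((Pi.basisFun ℂ (Fin N)).exteriorPower L).sum_repr (exteriorPower.ιMulti ℂ L v)]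
  refine Finset.sum_congr rfl fun u _ => ?_
  rw [exteriorPower.basis_repr_apply, exteriorPower.ιMultiDual_apply_ιMulti,
    exteriorPower.basis_apply, basisVec]
  rfl

theorem prod_zpow_eq_zpow_sum {ι F : Type*} [Field F] {x : F} (hx : x ≠ 0) (s : Finset ι)
    (f : ι → ℤ) : ∏ i ∈ s, x ^ f i = x ^ ∑ i ∈ s, f i := by
  induction s using Finset.cons_induction with
  | empty => simp
  | cons i s hi ih => rw [Finset.prod_cons, Finset.sum_cons, zpow_add₀ hx, ih]

theorem osculatingVec_orderEmbOfFin {L N : ℕ} (u : Set.powersetCard (Fin N) L) {x : ℂ}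
    (hx : x ≠ 0) (i : ℕ) (j : Fin L) :
    osculatingVec N i x (Finset.orderEmbOfFin u.1 u.2 j) =
      x ^ (-(i : ℤ)) * (x ^ (elt u j : ℤ) * ((elt u j).choose i : ℂ)) := by
  change ((elt u j).choose i : ℂ) * x ^ (elt u j - i) = _
  rcases le_or_gt i (elt u j) with hle | hlt
  · rw [← zpow_natCast, Nat.cast_sub hle, sub_eq_add_neg, zpow_add₀ hx]
    ring
  · simp [Nat.choose_eq_zero_of_lt hlt]

theorem det_osculatingVec_orderEmbOfFin {L N : ℕ} (u : Set.powersetCard (Fin N) L) {x : ℂ}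
    (hx : x ≠ 0) :
    (Matrix.of fun i j : Fin L =>
        osculatingVec N i x (Finset.orderEmbOfFin u.1 u.2 j)).det =
      vdm u * x ^ ((∑ k, (elt u k : ℤ)) - ∑ k : Fin L, ((k : ℕ) : ℤ)) := by
  have hmatrix : (Matrix.of fun i j : Fin L =>
      osculatingVec N i x (Finset.orderEmbOfFin u.1 u.2 j)) =
      Matrix.of fun i j : Fin L => x ^ (-((i : ℕ) : ℤ)) *
        (Matrix.of fun i j : Fin L => x ^ (elt u j : ℤ) *
          (Matrix.of fun i j : Fin L => ((elt u i).choose j : ℂ)).transpose i j) i j := by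
    ext i j
    exact osculatingVec_orderEmbOfFin u hx i j
  rw [hmatrix, Matrix.det_mul_column, Matrix.det_mul_row, Matrix.det_transpose, det_choose, vdm,
    prod_zpow_eq_zpow_sum hx, prod_zpow_eq_zpow_sum hx, Finset.sum_neg_distrib, sub_eq_add_neg,
    zpow_add₀ hx]
  ring

/-- The exterior product of the first `L` osculating vectors of the moment curve at `x`, so that
the product over points `x_k` has the confluent Vandermonde determinant as its top coefficient. -/
def osculatingWedge {R : Type*} [CommRing R] (L N : ℕ) (x : R) : ExteriorAlgebra R (Fin N → R) :=
  ExteriorAlgebra.ιMulti R L fun l : Fin L => osculatingVec N l x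

theorem osculatingWedge_eq_sum {L N : ℕ} {x : ℂ} (hx : x ≠ 0) :
    osculatingWedge L N x = ∑ u : Set.powersetCard (Fin N) L,
      (vdm u * x ^ ((∑ k, (elt u k : ℤ)) - ∑ k : Fin L, ((k : ℕ) : ℤ))) •
        (basisVec u : ExteriorAlgebra ℂ (Fin N → ℂ)) := by
  rw [osculatingWedge, ← exteriorPower.ιMulti_apply_coe, ιMulti_eq_sum_det,
    AddSubmonoidClass.coe_finsetSum]
  refine Finset.sum_congr rfl fun u _ => ?_
  rw [Submodule.coe_smul, det_osculatingVec_orderEmbOfFin u hx]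

theorem prod_ofFn_osculatingWedge {R : Type*} [CommRing R] {L : ℕ} (hL : 0 < L) (N K : ℕ)
    (z : ℕ → R) :
    (List.ofFn fun k : Fin K => osculatingWedge L N (z k)).prod =
      ExteriorAlgebra.ιMulti R (L * K) fun i => osculatingVec N (i % L) (z (i / L)) := by
  rw [← prod_ofFn_ιMulti L K fun i => osculatingVec N (i % L) (z (i / L))]
  simp only [osculatingWedge, Nat.mul_add_mod, Nat.mod_eq_of_lt (Fin.is_lt _),
    Nat.mul_add_div hL, Nat.div_eq_of_lt (Fin.is_lt _), add_zero]

theorem hodgeStarTop_prod_osculatingWedge {L K : ℕ} (hL : 0 < L) (x : Fin K → ℂ) :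
    hodgeStarTop (L * K) (List.ofFn fun k => osculatingWedge L (L * K) (x k)).prod =
      ∏ k, ∏ j ∈ Finset.Iio k, (x k - x j) ^ (L ^ 2) := by
  obtain ⟨z, rfl⟩ : ∃ z : ℕ → ℂ, (fun k : Fin K => z k) = x :=
    ⟨fun n => if h : n < K then x ⟨n, h⟩ else 0, by ext k; simp⟩
  rw [prod_ofFn_osculatingWedge hL (L * K) K z, hodgeStarTop_ιMulti,
    det_osculatingVec_eq_prod_sub_pow L z hL K,
    ← Fin.prod_univ_eq_prod_range (fun k => ∏ j ∈ Finset.range k, (z k - z j) ^ (L ^ 2))]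
  refine Finset.prod_congr rfl fun k _ => ?_
  rw [← Nat.Iio_eq_range, ← Fin.map_valEmbedding_Iio, Finset.prod_map]
  rfl

/-! ### Integration over the torus -/

instance : haarCircle.IsHaarMeasure := by unfold haarCircle; infer_instance

instance : IsProbabilityMeasure haarCircle :=
  ⟨Measure.haarMeasure_self (K₀ := (⊤ : TopologicalSpace.PositiveCompacts Circle))⟩

/-- Haar probability measure on the torus `𝕋^n`. -/
abbrev haarTorus (n : ℕ) : Measure (Fin n → Circle) := Measure.pi fun _ => haarCircle

theorem integrable_of_continuous {X E : Type*} [TopologicalSpace X] [CompactSpace X]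
    [MeasurableSpace X] [OpensMeasurableSpace X] [NormedAddCommGroup E] {μ : Measure X}
    [IsFiniteMeasureOnCompacts μ] {f : X → E} (hf : Continuous f) : Integrable f μ :=
  hf.integrable_of_hasCompactSupport (HasCompactSupport.of_compactSpace f)

@[fun_prop]
theorem continuous_coe_circle : Continuous fun x : Circle => (x : ℂ) := continuous_subtype_val

@[fun_prop]
theorem continuous_coe_zpow (n : ℤ) : Continuous fun x : Circle => (x : ℂ) ^ n := by
  simp only [← Circle.coe_zpow]
  exact continuous_coe_circle.comp (continuous_zpow n)

theorem integral_zpow (n : ℤ) :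
    ∫ x : Circle, (x : ℂ) ^ n ∂haarCircle = if n = 0 then 1 else 0 := by
  split_ifs with hn
  · simp [hn]
  · set g : Circle := Circle.exp (Real.pi / n)
    have hg : (g : ℂ) ^ n = -1 := by
      rw [← Circle.coe_zpow, ← Circle.exp_intCast_mul, mul_div_cancel₀ _ (Int.cast_ne_zero.2 hn)]
      simp
    have hrotate := integral_mul_left_eq_self (μ := haarCircle) (fun x : Circle => (x : ℂ) ^ n) g
    simp only [Circle.coe_mul, mul_zpow, hg, integral_const_mul] at hrotate
    linear_combination (-1 / 2 : ℂ) * hrotate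

theorem integral_eval_inv (p : Polynomial ℂ) :
    ∫ x : Circle, p.eval ((x : ℂ)⁻¹) ∂haarCircle = p.eval 0 := by
  have hpow (i : ℕ) : (fun x : Circle => p.coeff i * (x : ℂ)⁻¹ ^ i) =
      fun x : Circle => p.coeff i * (x : ℂ) ^ (-(i : ℤ)) := by simp
  simp only [Polynomial.eval_eq_sum_range]
  rw [integral_finsetSum _ fun i _ => by
    rw [hpow]
    exact integrable_of_continuous (by fun_prop)]
  refine Finset.sum_congr rfl fun i _ => ?_
  rw [hpow, integral_const_mul, integral_zpow, zero_pow_eq]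
  simp only [neg_eq_zero, Nat.cast_eq_zero]

/-- Evaluation of Laurent polynomials at a point of the circle. -/
def laurentEval (x : Circle) : LaurentPolynomial ℂ →+* ℂ :=
  LaurentPolynomial.eval₂ (RingHom.id ℂ) (Circle.toUnits x)

theorem laurentEval_T (x : Circle) (n : ℤ) :
    laurentEval x (LaurentPolynomial.T n) = (x : ℂ) ^ n := by
  simp [laurentEval]

theorem laurentEval_C (x : Circle) (a : ℂ) :
    laurentEval x (LaurentPolynomial.C a) = a := by
  simp [laurentEval]

@[fun_prop]
theorem continuous_laurentEval (p : LaurentPolynomial ℂ) :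
    Continuous fun x : Circle => laurentEval x p := by
  induction p using LaurentPolynomial.induction_on' with
  | add p q hp hq =>
    simp only [map_add]
    exact hp.add hq
  | C_mul_T n a =>
    simp only [map_mul, laurentEval_T, laurentEval_C]
    fun_prop

theorem integral_laurentEval_mul_zpow (p : LaurentPolynomial ℂ) (d : ℤ) :
    ∫ x : Circle, laurentEval x p * (x : ℂ) ^ (-d) ∂haarCircle = p.coeff d := by
  induction p using LaurentPolynomial.induction_on' with
  | add p q hp hq =>
    simp only [map_add, add_mul]
    rw [integral_add (integrable_of_continuous (by fun_prop))
      (integrable_of_continuous (by fun_prop)), hp, hq]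
    rfl
  | C_mul_T n a =>
    have hzpow (x : Circle) :
        laurentEval x (LaurentPolynomial.C a * LaurentPolynomial.T n) * (x : ℂ) ^ (-d) =
          a * (x : ℂ) ^ (n - d) := by
      rw [map_mul, laurentEval_T, laurentEval_C, sub_eq_add_neg,
        zpow_add₀ (Circle.coe_ne_zero x), mul_assoc]
    simp only [hzpow]
    rw [integral_const_mul, integral_zpow, ← LaurentPolynomial.single_eq_C_mul_T]
    simp [Finsupp.single_apply, sub_eq_zero, -LaurentPolynomial.single_eq_C_mul_T]

/-! ### The Dyson constant term identity -/

theorem sub_single_add_single {ι : Type*} [DecidableEq ι] {a : ι → ℕ} {i : ι} (ha : a i ≠ 0) :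
    a - Pi.single i 1 + Pi.single i 1 = a :=
  tsub_add_cancel_of_le <| update_le_iff.2 ⟨Nat.one_le_iff_ne_zero.2 ha, fun _ _ => Nat.zero_le _⟩

section Dyson

variable {ι F : Type*} [Fintype ι] [DecidableEq ι] [Field F]

/-- Dyson's product `∏_{i ≠ j} (1 - x_i / x_j)^{a_i}`, whose constant term as a Laurent polynomial
in `x` is a multinomial coefficient. -/
def dysonProd (a : ι → ℕ) (x : ι → F) : F :=
  ∏ i, (∏ j ∈ {i}ᶜ, (1 - x i / x j)) ^ a i

theorem dysonProd_add_single (a : ι → ℕ) (i : ι) (x : ι → F) :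
    dysonProd (a + Pi.single i 1) x = dysonProd a x * ∏ j ∈ {i}ᶜ, (1 - x i / x j) := by
  simp only [dysonProd, Pi.add_apply, pow_add, Finset.prod_mul_distrib, Pi.single_apply, pow_ite,
    pow_one, pow_zero, Finset.prod_ite_eq', Finset.mem_univ, if_true]

theorem dysonProd_eq_zero {a : ι → ℕ} {x : ι → F} {p q : ι} (hpq : p ≠ q) (hx : x p = x q)
    (hxq : x q ≠ 0) (ha : a p ≠ 0) : dysonProd a x = 0 := by
  refine Finset.prod_eq_zero (Finset.mem_univ p) ?_
  rw [Finset.prod_eq_zero (i := q) (by simpa using hpq.symm) (by rw [hx, div_self hxq, sub_self]),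
    zero_pow ha]

theorem prod_one_sub_div_ne_zero {x : ι → F} (hx : Function.Injective x) (hx0 : ∀ i, x i ≠ 0)
    (i : ι) : ∏ j ∈ {i}ᶜ, (1 - x i / x j) ≠ 0 := by
  refine Finset.prod_ne_zero_iff.2 fun j hj => sub_ne_zero.2 fun h => ?_
  have hji : j ≠ i := by simpa using hj
  exact hji (hx ((div_eq_one_iff_eq (hx0 j)).1 h.symm)).symm

theorem sum_inv_prod_one_sub_div [Nonempty ι] {x : ι → F} (hx : Function.Injective x)
    (hx0 : ∀ i, x i ≠ 0) : ∑ i, (∏ j ∈ {i}ᶜ, (1 - x i / x j))⁻¹ = 1 := by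
  have hlagrange := congrArg (Polynomial.eval 0)
    (Lagrange.sum_basis (s := Finset.univ) (v := x) hx.injOn Finset.univ_nonempty)
  rw [Polynomial.eval_finsetSum, Polynomial.eval_one] at hlagrange
  refine (Finset.sum_congr rfl fun i _ => ?_).trans hlagrange
  rw [Lagrange.basis, Polynomial.eval_prod, ← Finset.prod_inv_distrib, Finset.compl_singleton]
  refine Finset.prod_congr rfl fun j hj => ?_
  have hij : x i - x j ≠ 0 := sub_ne_zero.2 (hx.ne (Finset.ne_of_mem_erase hj).symm)
  have hji : x j - x i ≠ 0 := sub_ne_zero.2 (hx.ne (Finset.ne_of_mem_erase hj))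
  rw [one_sub_div (hx0 j), inv_div]
  simp only [Lagrange.basisDivisor, Polynomial.eval_mul, Polynomial.eval_C, Polynomial.eval_sub,
    Polynomial.eval_X]
  field_simp
  ring

theorem dysonProd_eq_sum_sub_single [Nonempty ι] {a : ι → ℕ} (ha : ∀ i, a i ≠ 0) {x : ι → F}
    (hx0 : ∀ i, x i ≠ 0) : dysonProd a x = ∑ i, dysonProd (a - Pi.single i 1) x := by
  by_cases hx : Function.Injective x
  · rw [← mul_one (dysonProd a x), ← sum_inv_prod_one_sub_div hx hx0, Finset.mul_sum]
    refine Finset.sum_congr rfl fun i _ => ?_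
    rw [← div_eq_mul_inv, div_eq_iff (prod_one_sub_div_ne_zero hx hx0 i),
      ← dysonProd_add_single, sub_single_add_single (ha i)]
  · obtain ⟨p, q, hxpq, hpq⟩ : ∃ p q, x p = x q ∧ p ≠ q := by
      simpa [Function.Injective] using hx
    rw [dysonProd_eq_zero hpq hxpq (hx0 q) (ha p), Finset.sum_eq_zero]
    intro i _
    rcases eq_or_ne i p with rfl | hip
    · exact dysonProd_eq_zero hpq.symm hxpq.symm (hx0 i) (by simp [hpq.symm, ha q])
    · exact dysonProd_eq_zero hpq hxpq (hx0 q) (by simp [hip.symm, ha p])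

theorem prod_factorial_add_single (a : ι → ℕ) (i : ι) :
    ∏ k, ((a + Pi.single i 1 : ι → ℕ) k).factorial = (a i + 1) * ∏ k, (a k).factorial := by
  have hfactorial (k : ι) : ((a + Pi.single i 1 : ι → ℕ) k).factorial =
      (if k = i then a i + 1 else 1) * (a k).factorial := by
    rcases eq_or_ne k i with rfl | hk
    · simp [Nat.factorial_succ]
    · simp [hk]
  simp only [hfactorial, Finset.prod_mul_distrib, Finset.prod_ite_eq', Finset.mem_univ, if_true]

theorem prod_factorial_mul_multinomial_sub_single {a : ι → ℕ} {i : ι} (ha : a i ≠ 0) :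
    (∏ k, (a k).factorial) * Nat.multinomial Finset.univ (a - Pi.single i 1) =
      a i * (∑ k, a k - 1).factorial := by
  obtain ⟨b, rfl⟩ : ∃ b : ι → ℕ, a = b + Pi.single i 1 := ⟨_, (sub_single_add_single ha).symm⟩
  have hsum : ∑ k, (b + Pi.single i 1 : ι → ℕ) k = ∑ k, b k + 1 := by
    simp [Finset.sum_add_distrib]
  rw [add_tsub_cancel_right, prod_factorial_add_single, mul_assoc, Nat.multinomial_spec, hsum,
    add_tsub_cancel_right, Pi.add_apply, Pi.single_eq_same]

theorem multinomial_eq_sum_sub_single [Nonempty ι] {a : ι → ℕ} (ha : ∀ i, a i ≠ 0) :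
    Nat.multinomial Finset.univ a = ∑ i, Nat.multinomial Finset.univ (a - Pi.single i 1) := by
  have hsum : ∑ i, a i ≠ 0 := fun h =>
    ha (Classical.arbitrary ι) (Finset.sum_eq_zero_iff.1 h _ (Finset.mem_univ _))
  have hpos : 0 < ∏ i, (a i).factorial := Finset.prod_pos fun i _ => Nat.factorial_pos _
  refine Nat.eq_of_mul_eq_mul_left hpos ?_
  simp only [Nat.multinomial_spec, Finset.mul_sum,
    prod_factorial_mul_multinomial_sub_single (ha _)]
  rw [← Finset.sum_mul, Nat.mul_factorial_pred hsum]

theorem multinomial_succAbove {n : ℕ} {a : Fin (n + 1) → ℕ} {i : Fin (n + 1)} (ha : a i = 0) :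
    Nat.multinomial Finset.univ a = Nat.multinomial Finset.univ fun j => a (i.succAbove j) := by
  have hpos : 0 < ∏ i, (a i).factorial := Finset.prod_pos fun i _ => Nat.factorial_pos _
  refine Nat.eq_of_mul_eq_mul_left hpos ?_
  rw [Nat.multinomial_spec, Fin.prod_univ_succAbove _ i, Fin.sum_univ_succAbove _ i, ha,
    Nat.factorial_zero, one_mul, zero_add, Nat.multinomial_spec]

theorem prod_compl_singleton_succAbove {A : Type*} [CommMonoid A] {n : ℕ} (i : Fin (n + 1))
    (k : Fin n) (f : Fin (n + 1) → A) :
    ∏ j ∈ {i.succAbove k}ᶜ, f j = f i * ∏ j ∈ {k}ᶜ, f (i.succAbove j) := by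
  have hcompl : ({i.succAbove k}ᶜ : Finset (Fin (n + 1))) =
      insert i (({k}ᶜ : Finset (Fin n)).map i.succAboveEmb) := by
    ext j
    induction j using i.succAboveCases with
    | x => simp
    | p j => simp
  rw [hcompl, Finset.prod_insert (by simp), Finset.prod_map]
  rfl

theorem dysonProd_insertNth {n : ℕ} {a : Fin (n + 1) → ℕ} {i : Fin (n + 1)} (ha : a i = 0)
    (t : F) (z : Fin n → F) :
    dysonProd a (i.insertNth (α := fun _ => F) t z) =
      (∏ j, (1 - z j / t) ^ a (i.succAbove j)) * dysonProd (fun j => a (i.succAbove j)) z := by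
  simp only [dysonProd, Fin.prod_univ_succAbove _ i, ha, pow_zero, one_mul,
    prod_compl_singleton_succAbove, Fin.insertNth_apply_same, Fin.insertNth_apply_succAbove,
    mul_pow, Finset.prod_mul_distrib]

end Dyson

@[fun_prop]
theorem continuous_dysonProd_coe {ι : Type*} [Fintype ι] [DecidableEq ι] (a : ι → ℕ) :
    Continuous fun x : ι → Circle => dysonProd a fun i => (x i : ℂ) := by
  have hcont (i : ι) : Continuous fun x : ι → Circle => (x i : ℂ) := by fun_prop
  exact continuous_finsetProd _ fun i _ => (continuous_finsetProd _ fun j _ =>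
    continuous_const.sub ((hcont i).div₀ (hcont j) fun x => Circle.coe_ne_zero (x j))).pow _

theorem integral_prod_one_sub_div_pow {n : ℕ} (a : Fin n → ℕ) (z : Fin n → ℂ) :
    ∫ t : Circle, ∏ j, (1 - z j / (t : ℂ)) ^ a j ∂haarCircle = 1 := by
  have heval := integral_eval_inv (∏ j, (1 - Polynomial.C (z j) * Polynomial.X) ^ a j)
  simpa [Polynomial.eval_prod, ← div_eq_mul_inv] using heval

theorem integral_dysonProd_of_eq_zero {n : ℕ} {a : Fin (n + 1) → ℕ} {i : Fin (n + 1)}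
    (ha : a i = 0) :
    ∫ x, dysonProd a (fun k => (x k : ℂ)) ∂(haarTorus (n + 1)) =
      ∫ x, dysonProd (fun j => a (i.succAbove j)) (fun k => (x k : ℂ)) ∂(haarTorus n) := by
  have hinsert (t : Circle) (z : Fin n → Circle) :
      dysonProd a (fun k => ((i.insertNth (α := fun _ => Circle) t z k : Circle) : ℂ)) =
        (∏ j, (1 - (z j : ℂ) / t) ^ a (i.succAbove j)) *
          dysonProd (fun j => a (i.succAbove j)) fun k => (z k : ℂ) := by
    rw [← dysonProd_insertNth ha]
    congr 1
    ext k
    induction k using i.succAboveCases with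
    | x => simp
    | p k => simp
  have hpreserving := (measurePreserving_piFinSuccAbove (fun _ => haarCircle) i).symm
  rw [haarTorus, ← hpreserving.integral_comp' fun x => dysonProd a fun k => (x k : ℂ)]
  change ∫ p : Circle × (Fin n → Circle),
    dysonProd a (fun k => ((i.insertNth (α := fun _ => Circle) p.1 p.2 k : Circle) : ℂ)) ∂_ = _
  rw [integral_prod_symm]
  · simp only [hinsert, integral_mul_const, integral_prod_one_sub_div_pow, one_mul]
  · have hcont : Continuous fun p : Circle × (Fin n → Circle) =>
        i.insertNth (α := fun _ => Circle) p.1 p.2 :=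
      continuous_fst.finInsertNth (A := fun _ => Circle) i continuous_snd
    exact integrable_of_continuous ((continuous_dysonProd_coe a).comp hcont)

theorem integral_dysonProd {n : ℕ} (a : Fin n → ℕ) :
    ∫ x, dysonProd a (fun i => (x i : ℂ)) ∂(haarTorus n) =
      (Nat.multinomial Finset.univ a : ℂ) := by
  induction n with
  | zero => simp [dysonProd]
  | succ n ihn =>
    induction hs : ∑ i, a i using Nat.strong_induction_on generalizing a with
    | _ s ihs =>
      by_cases ha : ∃ i, a i = 0
      · obtain ⟨i, hi⟩ := ha
        rw [integral_dysonProd_of_eq_zero hi, ihn, multinomial_succAbove hi]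
      · push Not at ha
        have hlt (i : Fin (n + 1)) : ∑ k, (a - Pi.single i 1 : Fin (n + 1) → ℕ) k < s := by
          rw [← hs]
          exact Finset.sum_lt_sum (fun k _ => tsub_le_self) ⟨i, Finset.mem_univ _, by
            simpa using Nat.sub_lt (Nat.pos_of_ne_zero (ha i)) one_pos⟩
        simp only [dysonProd_eq_sum_sub_single ha fun _ => Circle.coe_ne_zero _]
        rw [integral_finsetSum _ fun _ _ => integrable_of_continuous (by fun_prop),
          multinomial_eq_sum_sub_single ha, Nat.cast_sum]
        exact Finset.sum_congr rfl fun i _ => ihs _ (hlt i) _ rfl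

theorem norm_sub_sq_eq (x y : Circle) :
    ((‖(x : ℂ) - (y : ℂ)‖ : ℝ) : ℂ) ^ 2 =
      (1 - (x : ℂ) / (y : ℂ)) * (1 - (y : ℂ) / (x : ℂ)) := by
  have hx := Circle.coe_ne_zero x
  have hy := Circle.coe_ne_zero y
  rw [← Complex.mul_conj', map_sub, ← Circle.coe_inv_eq_conj, ← Circle.coe_inv_eq_conj,
    Circle.coe_inv, Circle.coe_inv]
  field_simp

theorem prod_prod_Iio_mul_eq_prod_prod_compl {ι A : Type*} [Fintype ι] [LinearOrder ι]
    [LocallyFiniteOrderBot ι] [LocallyFiniteOrderTop ι] [CommMonoid A] (f : ι → ι → A) :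
    ∏ k, ∏ j ∈ Finset.Iio k, (f j k * f k j) = ∏ k, ∏ j ∈ {k}ᶜ, f k j := by
  rw [prod_Iio_comm_prod_Ioi fun j k => f j k * f k j]
  exact Finset.prod_prod_Ioi_mul_eq_prod_prod_off_diag fun j k => f k j

theorem absVandermonde_eq_dysonProd {n : ℕ} (c : ℕ) (x : Fin n → Circle) :
    (absVandermonde (2 * c) x : ℂ) = dysonProd (fun _ => c) fun i => (x i : ℂ) := by
  simp only [dysonProd, absVandermonde, Complex.ofReal_prod, Complex.ofReal_pow, pow_mul,
    norm_sub_sq_eq]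
  simp only [Finset.prod_pow]
  rw [← prod_prod_Iio_mul_eq_prod_prod_compl fun i j => 1 - (x i : ℂ) / (x j : ℂ)]
  simp only [mul_comm]

theorem integral_absVandermonde (c n : ℕ) :
    ∫ x, absVandermonde (2 * c) x ∂(haarTorus n) =
      (Nat.multinomial (Finset.univ : Finset (Fin n)) fun _ => c : ℝ) := by
  have hdyson := integral_dysonProd (n := n) fun _ => c
  simp only [← absVandermonde_eq_dysonProd, integral_complex_ofReal] at hdyson
  exact_mod_cast hdyson

/-! ### The hyperpfaffian as a torus integral -/

theorem hodgeStarTop_smul {N : ℕ} (a : ℂ) (ω : ExteriorAlgebra ℂ (Fin N → ℂ)) :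
    hodgeStarTop N (a • ω) = a * hodgeStarTop N ω :=
  map_smul ((Pi.basisFun ℂ (Fin N)).ExteriorAlgebra.coord Finset.univ) a ω

section ListProd

variable {R A : Type*} [CommSemiring R] [Semiring A] [Algebra R A] {K : ℕ}

theorem prod_ofFn_smul (c : Fin K → R) (a : Fin K → A) :
    (List.ofFn fun k => c k • a k).prod = (∏ k, c k) • (List.ofFn a).prod := by
  simpa only [MultilinearMap.mkPiAlgebraFin_apply] using
    (MultilinearMap.mkPiAlgebraFin R K A).map_smul_univ c a

theorem prod_ofFn_sum_smul {U : Type*} [Fintype U] (g : Fin K → U → R) (e : U → A) :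
    (List.ofFn fun k => ∑ u, g k u • e u).prod =
      ∑ r : Fin K → U, (∏ k, g k (r k)) • (List.ofFn fun k => e (r k)).prod := by
  classical
  simp only [← prod_ofFn_smul]
  simpa only [MultilinearMap.mkPiAlgebraFin_apply] using
    (MultilinearMap.mkPiAlgebraFin R K A).map_sum fun k u => g k u • e u

end ListProd

/-- De Bruijn's integration formula in abstract form: by Fubini, integrating a product of forms in
separate variables amounts to integrating each factor. -/
theorem integral_prod_ofFn_sum_smul {𝕜 A X U : Type*} [RCLike 𝕜] [Ring A] [Algebra 𝕜 A]
    [MeasurableSpace X] {μ : Measure X} [SigmaFinite μ] [Fintype U] (φ : A →ₗ[𝕜] 𝕜) (e : U → A)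
    {g : U → X → 𝕜} (hg : ∀ u, Integrable (g u) μ) (K : ℕ) :
    ∫ x : Fin K → X, φ (List.ofFn fun k => ∑ u, g u (x k) • e u).prod
        ∂(Measure.pi fun _ => μ) =
      φ ((∑ u, (∫ t, g u t ∂μ) • e u) ^ K) := by
  rw [← List.prod_replicate, ← List.ofFn_const, prod_ofFn_sum_smul]
  simp only [prod_ofFn_sum_smul fun _ u => g u (_ : X), map_sum, map_smul, smul_eq_mul]
  rw [integral_finsetSum _ fun r _ => (Integrable.fintype_prod fun k => hg (r k)).mul_const _]
  refine Finset.sum_congr rfl fun r _ => ?_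
  rw [integral_mul_const, integral_fintype_prod_eq_prod fun k => g (r k)]

theorem prod_prod_Iio_mul_eq_prod_pow {ι A : Type*} [Fintype ι] [LinearOrder ι]
    [LocallyFiniteOrderBot ι] [LocallyFiniteOrderTop ι] [CommMonoid A] (f : ι → A) :
    ∏ k, ∏ j ∈ Finset.Iio k, (f j * f k) = ∏ k, f k ^ (Fintype.card ι - 1) := by
  rw [prod_prod_Iio_mul_eq_prod_prod_compl fun k _ => f k]
  simp only [Finset.prod_const, Finset.card_compl, Finset.card_singleton]

theorem norm_sub_pow_eq {c : ℕ} (hc : Even c) (x y : Circle) :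
    ((‖(x : ℂ) - (y : ℂ)‖ : ℝ) : ℂ) ^ (2 * c) =
      ((y : ℂ) ^ c * (x : ℂ) ^ c) * ((x : ℂ)⁻¹ - (y : ℂ)⁻¹) ^ (2 * c) := by
  have hsq : ((‖(x : ℂ) - (y : ℂ)‖ : ℝ) : ℂ) ^ 2 =
      -(((y : ℂ) * (x : ℂ)) * ((x : ℂ)⁻¹ - (y : ℂ)⁻¹) ^ 2) := by
    have hx := Circle.coe_ne_zero x
    have hy := Circle.coe_ne_zero y
    rw [norm_sub_sq_eq]
    field_simp
    ring
  rw [pow_mul, hsq, hc.neg_pow, mul_pow, mul_pow, ← pow_mul]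

theorem absVandermonde_eq_prod_inv {c K : ℕ} (hc : Even c) (x : Fin K → Circle) :
    (absVandermonde (2 * c) x : ℂ) = (∏ k, (x k : ℂ) ^ ((c : ℤ) * ((K : ℤ) - 1))) *
      ∏ k, ∏ j ∈ Finset.Iio k, ((x k : ℂ)⁻¹ - (x j : ℂ)⁻¹) ^ (2 * c) := by
  simp only [absVandermonde, Complex.ofReal_prod, Complex.ofReal_pow, norm_sub_pow_eq hc]
  simp only [Finset.prod_mul_distrib (f := fun j => (x j : ℂ) ^ c * (x _ : ℂ) ^ c)]
  rw [Finset.prod_mul_distrib, prod_prod_Iio_mul_eq_prod_pow fun k => (x k : ℂ) ^ c,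
    Fintype.card_fin]
  congr 1
  refine Finset.prod_congr rfl fun k _ => ?_
  rw [← Nat.cast_pred k.pos, ← Nat.cast_mul, zpow_natCast, pow_mul]

theorem exists_even_sq_eq_two_mul {L : ℕ} (hL : Even L) : ∃ c, Even c ∧ L ^ 2 = 2 * c := by
  obtain ⟨h, rfl⟩ := hL.two_dvd
  exact ⟨2 * h ^ 2, even_two_mul _, by ring⟩

theorem neg_delta_eq {L K c : ℕ} (hL : Even L) (hc : L ^ 2 = 2 * c)
    (u : Set.powersetCard (Fin (L * K)) L) :
    -delta u = (c : ℤ) * ((K : ℤ) - 1) -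
      ((∑ k, (elt u k : ℤ)) - ∑ k : Fin L, ((k : ℕ) : ℤ)) := by
  have hgauss : (∑ k : Fin L, ((k : ℕ) : ℤ)) * 2 = L * (L - 1) := by
    have hrange := Finset.sum_range_id_mul_two L
    rw [← Fin.sum_univ_eq_sum_range fun k => k] at hrange
    rcases L.eq_zero_or_pos with rfl | hpos
    · simp
    · rw [← Nat.cast_pred hpos]
      exact_mod_cast hrange
  have hdvd : (2 : ℤ) ∣ L * (((L * K : ℕ) : ℤ) - 1) :=
    (Int.natCast_dvd_natCast.2 hL.two_dvd).mul_right _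
  have hhalf := Int.ediv_mul_cancel hdvd
  have hc' : (L : ℤ) ^ 2 = 2 * c := by exact_mod_cast hc
  refine mul_right_cancel₀ (two_ne_zero (α := ℤ)) ?_
  rw [delta]
  push_cast at hhalf ⊢
  linear_combination hhalf - hgauss + ((K : ℤ) - 1) * hc'

/-- The one-variable `L`-form `∑_u t^{-δu} Δ̃u e_u`, whose product over points `t = x_k` of the
circle has `∏_{j < k} |x_k - x_j|^{L²}` as its top coefficient. -/
def vandermondeForm (L K : ℕ) (t : Circle) : ExteriorAlgebra ℂ (Fin (L * K) → ℂ) :=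
  ∑ u : Set.powersetCard (Fin (L * K)) L,
    ((t : ℂ) ^ (-delta u) * vdm u) • (basisVec u : ExteriorAlgebra ℂ (Fin (L * K) → ℂ))

theorem vandermondeForm_eq_smul_osculatingWedge {L c : ℕ} (K : ℕ) (hL : Even L)
    (hc : L ^ 2 = 2 * c) (t : Circle) :
    vandermondeForm L K t =
      (t : ℂ) ^ ((c : ℤ) * ((K : ℤ) - 1)) • osculatingWedge L (L * K) (t : ℂ)⁻¹ := by
  have ht := Circle.coe_ne_zero t
  rw [vandermondeForm, osculatingWedge_eq_sum (inv_ne_zero ht), Finset.smul_sum]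
  refine Finset.sum_congr rfl fun u _ => ?_
  rw [smul_smul, neg_delta_eq hL hc, sub_eq_add_neg, zpow_add₀ ht, inv_zpow', mul_assoc,
    mul_comm (vdm u)]

theorem hodgeStarTop_prod_vandermondeForm {L K : ℕ} (hL : Even L) (hL0 : 0 < L)
    (x : Fin K → Circle) :
    hodgeStarTop (L * K) (List.ofFn fun k => vandermondeForm L K (x k)).prod =
      absVandermonde (L ^ 2) x := by
  obtain ⟨c, hc, hLc⟩ := exists_even_sq_eq_two_mul hL
  simp only [vandermondeForm_eq_smul_osculatingWedge K hL hLc]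
  rw [prod_ofFn_smul, hodgeStarTop_smul,
    hodgeStarTop_prod_osculatingWedge hL0 fun k => (x k : ℂ)⁻¹, hLc, absVandermonde_eq_prod_inv hc]

theorem integral_prod_laurentEval_mul_absVandermonde {L : ℕ} (K : ℕ) (hL : Even L) (hL0 : 0 < L)
    (p : LaurentPolynomial ℂ) :
    ∫ x : Fin K → Circle, (∏ k, laurentEval (x k) p) * (absVandermonde (L ^ 2) x : ℂ)
        ∂(haarTorus K) =
      hodgeStarTop (L * K) ((∑ u : Set.powersetCard (Fin (L * K)) L,
        (p.coeff (delta u) * vdm u) •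
          (basisVec u : ExteriorAlgebra ℂ (Fin (L * K) → ℂ))) ^ K) := by
  have hdeBruijn := integral_prod_ofFn_sum_smul
    ((Pi.basisFun ℂ (Fin (L * K))).ExteriorAlgebra.coord Finset.univ)
    (fun u : Set.powersetCard (Fin (L * K)) L =>
      (basisVec u : ExteriorAlgebra ℂ (Fin (L * K) → ℂ)))
    (g := fun u t => laurentEval t p * (t : ℂ) ^ (-delta u) * vdm u) (μ := haarCircle)
    (fun u => integrable_of_continuous (by fun_prop)) K
  simp only [integral_mul_const, integral_laurentEval_mul_zpow] at hdeBruijn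
  refine Eq.trans ?_ hdeBruijn
  congr 1
  ext x
  have hform (t : Circle) : ∑ u : Set.powersetCard (Fin (L * K)) L,
      (laurentEval t p * (t : ℂ) ^ (-delta u) * vdm u) •
        (basisVec u : ExteriorAlgebra ℂ (Fin (L * K) → ℂ)) =
      laurentEval t p • vandermondeForm L K t := by
    simp only [vandermondeForm, Finset.smul_sum, smul_smul, mul_assoc]
  simp only [hform]
  rw [prod_ofFn_smul, map_smul, smul_eq_mul, ← hodgeStarTop_prod_vandermondeForm hL hL0 x]
  rfl

theorem laurent_two_mul (c : ℕ) {m : ℕ} (y : Fin m → Circle) :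
    laurent (2 * c) y = LaurentPolynomial.T (-((c * m : ℕ) : ℤ)) *
      Polynomial.toLaurent (∏ j, (Polynomial.X - Polynomial.C (y j : ℂ)) ^ (2 * c)) := by
  rw [laurent, mul_assoc 2 c m, Nat.mul_div_cancel_left _ two_pos]
  simp only [map_prod, map_pow, map_sub, Polynomial.toLaurent_X, Polynomial.toLaurent_C]

theorem laurent_coeff_eq_zero (c : ℕ) {m : ℕ} (y : Fin m → Circle) {d : ℤ}
    (hd : ((c * m : ℕ) : ℤ) < |d|) : (laurent (2 * c) y).coeff d = 0 := by
  rw [laurent_two_mul]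
  set p : Polynomial ℂ := ∏ j, (Polynomial.X - Polynomial.C (y j : ℂ)) ^ (2 * c) with hp
  have hdeg : p.natDegree = 2 * (c * m) := by
    rw [hp, Polynomial.natDegree_prod_of_monic _ _ fun j _ => (Polynomial.monic_X_sub_C _).pow _]
    simp only [(Polynomial.monic_X_sub_C _).natDegree_pow, Polynomial.natDegree_X_sub_C,
      Finset.sum_const, Finset.card_univ, Fintype.card_fin, smul_eq_mul]
    ring
  rw [p.as_sum_range_C_mul_X_pow, map_sum, Finset.mul_sum, AddMonoidAlgebra.coeff_sum,
    Finsupp.finsetSum_apply]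
  refine Finset.sum_eq_zero fun i hi => ?_
  have hi' := Finset.mem_range.1 hi
  rw [map_mul, Polynomial.toLaurent_C, Polynomial.toLaurent_X_pow, mul_left_comm,
    ← LaurentPolynomial.T_add, ← LaurentPolynomial.single_eq_C_mul_T,
    AddMonoidAlgebra.coeff_single, Finsupp.single_apply, if_neg]
  rw [lt_abs] at hd
  lia

theorem laurentEval_laurent (c : ℕ) {m : ℕ} (y : Fin m → Circle) (x : Circle) :
    laurentEval x (laurent (2 * c) y) =
      ∏ j, ((x : ℂ) ^ (-(c : ℤ)) * ((x : ℂ) - (y j : ℂ)) ^ (2 * c)) := by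
  rw [laurent, map_mul, laurentEval_T, map_prod, Finset.prod_mul_distrib, Finset.prod_const,
    Finset.card_univ, Fintype.card_fin, ← zpow_natCast, ← zpow_mul, mul_assoc 2 c m,
    Nat.mul_div_cancel_left _ two_pos, Nat.cast_mul, neg_mul]
  simp only [map_pow, map_sub, laurentEval_T, laurentEval_C, zpow_one]

theorem prod_norm_sub_pow_eq {c m : ℕ} (hc : Even c) (x : Circle) (y : Fin m → Circle) :
    (∏ j, ((‖(x : ℂ) - (y j : ℂ)‖ : ℝ) : ℂ) ^ (2 * c)) =
      laurentEval x (laurent (2 * c) y) * ∏ j, (y j : ℂ) ^ (-(c : ℤ)) := by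
  rw [laurentEval_laurent, ← Finset.prod_mul_distrib]
  refine Finset.prod_congr rfl fun j _ => ?_
  have hx := Circle.coe_ne_zero x
  have hy := Circle.coe_ne_zero (y j)
  have hinv : (x : ℂ)⁻¹ - (y j : ℂ)⁻¹ = -(((x : ℂ) - (y j : ℂ)) * ((x : ℂ)⁻¹ * (y j : ℂ)⁻¹)) := by
    field_simp
    ring
  rw [norm_sub_pow_eq hc, hinv, (even_two_mul c).neg_pow, mul_pow, mul_pow, inv_pow, inv_pow,
    zpow_neg, zpow_neg, zpow_natCast, zpow_natCast, two_mul c, pow_add (x : ℂ),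
    pow_add (y j : ℂ)]
  field_simp

theorem coe_gammaVec {L : ℕ} (K : ℕ) (hL : Even L) {m : ℕ} (y : Fin m → Circle) :
    (gammaVec L K y : ExteriorAlgebra ℂ (Fin (L * K) → ℂ)) =
      ∑ u : Set.powersetCard (Fin (L * K)) L, ((laurent (L ^ 2) y).coeff (delta u) * vdm u) •
        (basisVec u : ExteriorAlgebra ℂ (Fin (L * K) → ℂ)) := by
  obtain ⟨c, -, hLc⟩ := exists_even_sq_eq_two_mul hL
  rw [gammaVec, AddSubmonoidClass.coe_finsetSum]
  simp only [Submodule.coe_smul]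
  refine Finset.sum_subset (Finset.filter_subset _ _) fun u _ hu => ?_
  have hdelta : ((c * m : ℕ) : ℤ) < |delta u| := by
    simpa [hLc, mul_assoc 2 c m] using hu
  rw [hLc, laurent_coeff_eq_zero c y hdelta, zero_mul, zero_smul]

theorem integral_absVandermonde_mul_prod {L : ℕ} (K : ℕ) (hL : Even L) (hL0 : 0 < L) {m : ℕ}
    (y : Fin m → Circle) :
    ∫ x : Fin K → Circle, ((absVandermonde (L ^ 2) x : ℂ) *
        ∏ k, ∏ j, ((‖(x k : ℂ) - (y j : ℂ)‖ : ℝ) : ℂ) ^ (L ^ 2)) ∂(haarTorus K) =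
      (∏ n, (y n : ℂ) ^ (-((L ^ 2 * K / 2 : ℕ) : ℤ))) *
        hodgeStarTop (L * K) ((gammaVec L K y : ExteriorAlgebra ℂ (Fin (L * K) → ℂ)) ^ K) := by
  obtain ⟨c, hc, hLc⟩ := exists_even_sq_eq_two_mul hL
  have hphase : ∏ n, (y n : ℂ) ^ (-((L ^ 2 * K / 2 : ℕ) : ℤ)) =
      (∏ j, (y j : ℂ) ^ (-(c : ℤ))) ^ K := by
    rw [hLc, mul_assoc 2, Nat.mul_div_cancel_left _ two_pos, ← Finset.prod_pow]
    simp only [← zpow_natCast, ← zpow_mul, Nat.cast_mul, neg_mul]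
  rw [coe_gammaVec K hL, ← integral_prod_laurentEval_mul_absVandermonde K hL hL0, hphase,
    ← integral_const_mul]
  congr 1
  ext x
  simp only [hLc, prod_norm_sub_pow_eq hc, Finset.prod_mul_distrib, Finset.prod_const,
    Finset.card_univ, Fintype.card_fin]
  ring

/-! ### Splitting a configuration -/

/-- The configuration `(y₁, …, y_m, x₁, …, x_{M-m})`. -/
def join {W : Type*} {m M : ℕ} (hm : m ≤ M) (y : Fin m → W) (x : Fin (M - m) → W) : Fin M → W :=
  fun i => Fin.append y x (Fin.cast (Nat.add_sub_of_le hm).symm i)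

/-- The identification of the index set of `join` with the disjoint union of those of its parts. -/
def joinIndex {m M : ℕ} (hm : m ≤ M) : Fin m ⊕ Fin (M - m) ≃ Fin M :=
  finSumFinEquiv.trans (finCongr (Nat.add_sub_of_le hm))

theorem measurePreserving_comp_equiv {ι ι' W : Type*} [Fintype ι] [Fintype ι'] [MeasurableSpace W]
    (μ : Measure W) [SigmaFinite μ] (e : ι ≃ ι') :
    MeasurePreserving (fun x : ι' → W => x ∘ e) (Measure.pi fun _ => μ)
      (Measure.pi fun _ => μ) := by
  convert! measurePreserving_piCongrLeft (fun _ : ι => μ) e.symm using 1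
  funext x i
  obtain ⟨j, rfl⟩ := e.symm.surjective i
  rw [MeasurableEquiv.coe_piCongrLeft, Equiv.piCongrLeft_apply_apply, Function.comp_apply,
    Equiv.apply_symm_apply]

section Join

variable {W : Type*} {m M : ℕ} (hm : m ≤ M)

theorem join_joinIndex (y : Fin m → W) (x : Fin (M - m) → W) (s : Fin m ⊕ Fin (M - m)) :
    join hm y x (joinIndex hm s) = Sum.elim y x s := by
  rcases s with i | i <;> simp [join, joinIndex]

theorem join_eq_elim_comp (y : Fin m → W) (x : Fin (M - m) → W) :
    join hm y x = Sum.elim y x ∘ (joinIndex hm).symm := by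
  rw [Equiv.eq_comp_symm]
  exact funext (join_joinIndex hm y x)

theorem measurePreserving_join [MeasurableSpace W] (μ : Measure W) [SigmaFinite μ] :
    MeasurePreserving (fun p : (Fin m → W) × (Fin (M - m) → W) => join hm p.1 p.2)
      ((Measure.pi fun _ => μ).prod (Measure.pi fun _ => μ)) (Measure.pi fun _ => μ) := by
  convert! (measurePreserving_comp_equiv μ (joinIndex hm).symm).comp
    (measurePreserving_sumPiEquivProdPi_symm fun _ : Fin m ⊕ Fin (M - m) => μ) using 1
  funext p
  rw [join_eq_elim_comp, Function.comp_apply]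
  congr 1

theorem continuous_join [TopologicalSpace W] (y : Fin m → W) : Continuous (join hm y) := by
  refine continuous_pi fun i => ?_
  obtain ⟨s, rfl⟩ := (joinIndex hm).surjective i
  simp only [join_joinIndex]
  rcases s with i | i
  · exact continuous_const
  · exact continuous_apply i

end Join

/-! ### Correlation functions of exchangeable point processes -/

section Occupation

variable {W : Type*} {m M : ℕ}

theorem natCast_occupation (B : Set W) (x : Fin M → W) :
    (occupation B x : ENNReal) = ∑ i, B.indicator 1 (x i) := by
  classical
  simp only [occupation, Finset.card_filter, Nat.cast_sum, Nat.cast_ite, Nat.cast_one,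
    Nat.cast_zero, Set.indicator_apply, Pi.one_apply]

theorem prod_indicator_one_apply {ι R : Type*} [Fintype ι] [CommMonoidWithZero R]
    (B : ι → Set W) (y : ι → W) :
    ∏ k, (B k).indicator (1 : W → R) (y k) =
      (Set.univ.pi B).indicator (1 : (ι → W) → R) y := by
  classical
  simp only [Set.indicator_apply, Pi.one_apply, Finset.prod_ite_zero, Set.mem_univ_pi,
    Finset.mem_univ, true_imp_iff, Finset.prod_const_one]

theorem injective_of_comp_mem_pi {ι κ : Type*} {B : ι → Set W}
    (hdisj : Pairwise fun j k => Disjoint (B j) (B k)) {x : κ → W} {σ : ι → κ}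
    (hx : x ∘ σ ∈ Set.univ.pi B) : Function.Injective σ := by
  intro j k hjk
  by_contra hne
  refine Set.disjoint_left.1 (hdisj hne) (hx j (Set.mem_univ j)) ?_
  rw [Function.comp_apply, hjk]
  exact hx k (Set.mem_univ k)

theorem prod_occupation {B : Fin m → Set W} (hdisj : Pairwise fun j k => Disjoint (B j) (B k))
    (x : Fin M → W) :
    ∏ k, (occupation (B k) x : ENNReal) =
      ∑ σ : Fin m ↪ Fin M, ((· ∘ σ) ⁻¹' Set.univ.pi B).indicator 1 x := by
  classical
  calc ∏ k, (occupation (B k) x : ENNReal)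
      = ∑ σ : Fin m → Fin M, ((· ∘ σ) ⁻¹' Set.univ.pi B).indicator 1 x := by
        simp only [natCast_occupation, Finset.prod_univ_sum, Fintype.piFinset_univ]
        exact Finset.sum_congr rfl fun σ _ => prod_indicator_one_apply B (x ∘ σ)
    _ = ∑ σ : Fin m ↪ Fin M, ((· ∘ σ) ⁻¹' Set.univ.pi B).indicator 1 x := by
        refine (Fintype.sum_of_injective _ DFunLike.coe_injective _ _ (fun σ hσ => ?_)
          fun _ => rfl).symm
        refine Set.indicator_of_notMem (M := ENNReal) (fun hx => hσ ?_) _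
        exact ⟨⟨σ, injective_of_comp_mem_pi hdisj hx⟩, rfl⟩

variable [MeasurableSpace W]

theorem lintegral_prod_occupation (P : Measure (Fin M → W)) {B : Fin m → Set W}
    (hB : ∀ k, MeasurableSet (B k)) (hdisj : Pairwise fun j k => Disjoint (B j) (B k)) :
    ∫⁻ x, ∏ k, (occupation (B k) x : ENNReal) ∂P =
      ∑ σ : Fin m ↪ Fin M, P ((· ∘ σ) ⁻¹' Set.univ.pi B) := by
  have hmeas (σ : Fin m ↪ Fin M) : Measurable fun x : Fin M → W => x ∘ σ := by fun_prop
  simp only [prod_occupation hdisj]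
  rw [lintegral_finsetSum _ fun σ _ => measurable_one.indicator (hmeas σ (.univ_pi hB))]
  exact Finset.sum_congr rfl fun σ _ => lintegral_indicator_one (hmeas σ (.univ_pi hB))

theorem lintegral_prod_occupation_of_exchangeable {P : Measure (Fin M → W)}
    (hP : ∀ τ : Equiv.Perm (Fin M), MeasurePreserving (fun x => x ∘ τ) P P) {B : Fin m → Set W}
    (hB : ∀ k, MeasurableSet (B k)) (hdisj : Pairwise fun j k => Disjoint (B j) (B k))
    (σ₀ : Fin m ↪ Fin M) :
    ∫⁻ x, ∏ k, (occupation (B k) x : ENNReal) ∂P =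
      M.descFactorial m * P ((· ∘ σ₀) ⁻¹' Set.univ.pi B) := by
  have hmeas : MeasurableSet ((fun x : Fin M → W => x ∘ σ₀) ⁻¹' Set.univ.pi B) :=
    (by fun_prop : Measurable fun x : Fin M → W => x ∘ σ₀) (MeasurableSet.univ_pi hB)
  have hconst (σ : Fin m ↪ Fin M) :
      P ((· ∘ σ) ⁻¹' Set.univ.pi B) = P ((· ∘ σ₀) ⁻¹' Set.univ.pi B) := by
    obtain ⟨τ, rfl⟩ := Equiv.Perm.exists_smul_eq_embedding σ₀ σ
    exact (hP τ).measure_preimage hmeas.nullMeasurableSet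
  rw [lintegral_prod_occupation P hB hdisj, Finset.sum_congr rfl fun σ _ => hconst σ,
    Finset.sum_const, Finset.card_univ, Fintype.card_embedding_eq, Fintype.card_fin,
    Fintype.card_fin, nsmul_eq_mul]

end Occupation

section SymmetricDensity

variable {W : Type*} [MeasurableSpace W] (μ : Measure W) [SigmaFinite μ] {m M : ℕ}

theorem measurePreserving_comp_perm_withDensity {ι : Type*} [Fintype ι] {g : (ι → W) → ENNReal}
    (hg : Measurable g) {τ : Equiv.Perm ι} (hsymm : ∀ x, g (x ∘ τ) = g x) :
    MeasurePreserving (fun x => x ∘ τ) ((Measure.pi fun _ => μ).withDensity g)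
      ((Measure.pi fun _ => μ).withDensity g) := by
  have hτ := measurePreserving_comp_equiv μ τ
  refine ⟨hτ.measurable, Measure.ext fun S hS => ?_⟩
  rw [Measure.map_apply hτ.measurable hS, withDensity_apply _ (hτ.measurable hS),
    withDensity_apply _ hS, ← hτ.setLIntegral_comp_preimage hS hg]
  simp only [hsymm]

theorem withDensity_pi_comp_inl_preimage (hm : m ≤ M) {g : (Fin M → W) → ENNReal}
    (hg : Measurable g) {S : Set (Fin m → W)} (hS : MeasurableSet S) :
    (Measure.pi fun _ => μ).withDensity g {x | (fun k => x (joinIndex hm (Sum.inl k))) ∈ S} =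
      ∫⁻ y in S, ∫⁻ x, g (join hm y x) ∂(Measure.pi fun _ => μ) ∂(Measure.pi fun _ => μ) := by
  have hjoin := measurePreserving_join hm μ
  have hmeas : MeasurableSet {x : Fin M → W | (fun k => x (joinIndex hm (Sum.inl k))) ∈ S} :=
    (by fun_prop : Measurable fun (x : Fin M → W) k => x (joinIndex hm (Sum.inl k))) hS
  have hpreimage : (fun p : (Fin m → W) × (Fin (M - m) → W) => join hm p.1 p.2) ⁻¹'
      {x | (fun k => x (joinIndex hm (Sum.inl k))) ∈ S} = S ×ˢ Set.univ := by
    ext p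
    simp [join_joinIndex]
  rw [withDensity_apply _ hmeas, ← hjoin.setLIntegral_comp_preimage hmeas hg, hpreimage,
    setLIntegral_prod (fun p => g (join hm p.1 p.2)) (hg.comp hjoin.measurable).aemeasurable,
    Measure.restrict_univ]

theorem isCorrelationFunction_marginal (hm : m ≤ M) {f : (Fin M → W) → ℝ} (hf : Measurable f)
    (hf0 : ∀ x, 0 ≤ f x) (hsymm : ∀ (τ : Equiv.Perm (Fin M)) x, f (x ∘ τ) = f x)
    (hint : ∀ y, Integrable (fun x => f (join hm y x)) (Measure.pi fun _ => μ)) :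
    IsCorrelationFunction μ ((Measure.pi fun _ => μ).withDensity fun x => ENNReal.ofReal (f x)) m
      (fun y => (M.factorial : ℝ) / ((M - m).factorial : ℝ) *
        ∫ x, f (join hm y x) ∂(Measure.pi fun _ => μ)) := by
  have hfactorial : (M.factorial : ℝ) / ((M - m).factorial : ℝ) = M.descFactorial m := by
    rw [div_eq_iff (Nat.cast_ne_zero.2 (Nat.factorial_ne_zero _)), mul_comm]
    exact_mod_cast (Nat.factorial_mul_descFactorial hm).symm
  simp only [hfactorial]
  refine ⟨?_, fun y => ?_, fun B hB hdisj => ?_⟩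
  · exact (StronglyMeasurable.integral_prod_right (f := fun y x => f (join hm y x))
      (hf.comp (measurePreserving_join hm μ).measurable).stronglyMeasurable).measurable.const_mul _
  · exact mul_nonneg (Nat.cast_nonneg _) (integral_nonneg fun x => hf0 _)
  have hexch (τ : Equiv.Perm (Fin M)) :=
    measurePreserving_comp_perm_withDensity μ hf.ennreal_ofReal
      fun x => congrArg ENNReal.ofReal (hsymm τ x)
  rw [lintegral_prod_occupation_of_exchangeable hexch hB hdisj
      (Function.Embedding.inl.trans (joinIndex hm).toEmbedding)]
  refine (congrArg _ (withDensity_pi_comp_inl_preimage μ hm hf.ennreal_ofReal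
    (MeasurableSet.univ_pi hB))).trans ?_
  rw [← lintegral_const_mul' _ _ (ENNReal.natCast_ne_top _)]
  refine lintegral_congr fun y => ?_
  rw [ENNReal.ofReal_mul (Nat.cast_nonneg _), ENNReal.ofReal_natCast,
    ofReal_integral_eq_lintegral_ofReal (hint y) (Filter.Eventually.of_forall fun x => hf0 _)]

end SymmetricDensity

/-! ### Uniqueness of correlation functions -/

section Diagonal

variable {W : Type*} [MeasurableSpace W] [MeasurableEq W] (μ : Measure W) [SigmaFinite μ]
  [NullSingletonClass μ]

theorem ae_apply_ne_apply {m : ℕ} {i j : Fin m} (hij : i ≠ j) :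
    ∀ᵐ y ∂(Measure.pi fun _ : Fin m => μ), y i ≠ y j := by
  cases m with
  | zero => exact i.elim0
  | succ n =>
    obtain ⟨k, rfl⟩ := Fin.exists_succAbove_eq hij.symm
    have hdiag : MeasurableSet {p : W × (Fin n → W) | p.1 = p.2 k} :=
      measurableSet_eq_fun measurable_fst ((measurable_pi_apply k).comp measurable_snd)
    have hnull : (μ.prod (Measure.pi fun _ : Fin n => μ)) {p | p.1 = p.2 k} = 0 := by
      rw [Measure.prod_apply_symm hdiag]
      simp
    have hsplit := measurePreserving_piFinSuccAbove (fun _ : Fin (n + 1) => μ) i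
    rw [← hsplit.measure_preimage hdiag.nullMeasurableSet] at hnull
    exact compl_mem_ae_iff.2 hnull

theorem ae_injective (m : ℕ) :
    ∀ᵐ y ∂(Measure.pi fun _ : Fin m => μ), Function.Injective y := by
  have hpairs : ∀ᵐ y ∂(Measure.pi fun _ : Fin m => μ), ∀ i j, i ≠ j → y i ≠ y j := by
    simp only [ae_all_iff]
    exact fun i j hij => ae_apply_ne_apply μ hij
  filter_upwards [hpairs] with y hy
  exact Function.injective_iff_pairwise_ne.2 fun i j => hy i j

end Diagonal

theorem occupation_le {W : Type*} {M : ℕ} (B : Set W) (x : Fin M → W) : occupation B x ≤ M := by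
  classical
  exact (Finset.card_filter_le _ _).trans_eq (Finset.card_fin M)

namespace IsCorrelationFunction

variable {W : Type*} [MeasurableSpace W] {μ : Measure W} {m M : ℕ} {P : Measure (Fin M → W)}
  {R R' : (Fin m → W) → ℝ} {B : Fin m → Set W}

theorem setLIntegral_pi_ne_top [IsFiniteMeasure P] (hR : IsCorrelationFunction μ P m R)
    (hB : ∀ k, MeasurableSet (B k)) (hdisj : Pairwise fun j k => Disjoint (B j) (B k)) :
    ∫⁻ y in Set.univ.pi B, ENNReal.ofReal (R y) ∂(Measure.pi fun _ => μ) ≠ ⊤ := by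
  rw [← hR.expectation_eq B hB hdisj]
  have hbound (x : Fin M → W) :
      ∏ k, (occupation (B k) x : ENNReal) ≤ ∏ _k : Fin m, (M : ENNReal) :=
    Finset.prod_le_prod' fun k _ => Nat.cast_le.2 (occupation_le (B k) x)
  refine ne_top_of_le_ne_top ?_ (lintegral_mono hbound)
  rw [Finset.prod_const, lintegral_const]
  exact ENNReal.mul_ne_top (ENNReal.pow_ne_top (ENNReal.natCast_ne_top M)) (measure_ne_top _ _)

theorem withDensity_restrict_pi_apply_pi (hR : IsCorrelationFunction μ P m R)
    (hB : ∀ k, MeasurableSet (B k)) (hdisj : Pairwise fun j k => Disjoint (B j) (B k))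
    {C : Fin m → Set W} (hC : ∀ k, MeasurableSet (C k)) :
    ((Measure.pi fun _ => μ).restrict (Set.univ.pi B)).withDensity
        (fun y => ENNReal.ofReal (R y)) (Set.univ.pi C) =
      ∫⁻ x, ∏ k, (occupation (C k ∩ B k) x : ENNReal) ∂P := by
  rw [hR.expectation_eq (fun k => C k ∩ B k) (fun k => (hC k).inter (hB k))
    (fun j k hjk => (hdisj hjk).mono Set.inter_subset_right Set.inter_subset_right),
    withDensity_apply _ (MeasurableSet.univ_pi hC),
    Measure.restrict_restrict (MeasurableSet.univ_pi hC), Set.pi_inter_distrib]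

theorem ae_eq_restrict [IsFiniteMeasure P] (hR : IsCorrelationFunction μ P m R)
    (hR' : IsCorrelationFunction μ P m R') (hB : ∀ k, MeasurableSet (B k))
    (hdisj : Pairwise fun j k => Disjoint (B j) (B k)) :
    R =ᵐ[(Measure.pi fun _ => μ).restrict (Set.univ.pi B)] R' := by
  set ν := (Measure.pi fun _ : Fin m => μ).restrict (Set.univ.pi B)
  have hfinite := hR.setLIntegral_pi_ne_top hB hdisj
  have : IsFiniteMeasure (ν.withDensity fun y => ENNReal.ofReal (R y)) :=
    isFiniteMeasure_withDensity hfinite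
  have hbox {C : Fin m → Set W} (hC : ∀ k, MeasurableSet (C k)) :
      ν.withDensity (fun y => ENNReal.ofReal (R y)) (Set.univ.pi C) =
        ν.withDensity (fun y => ENNReal.ofReal (R' y)) (Set.univ.pi C) := by
    rw [hR.withDensity_restrict_pi_apply_pi hB hdisj hC,
      hR'.withDensity_restrict_pi_apply_pi hB hdisj hC]
  have hdensity : (ν.withDensity fun y => ENNReal.ofReal (R y)) =
      ν.withDensity fun y => ENNReal.ofReal (R' y) := by
    refine ext_of_generate_finite _ generateFrom_pi.symm isPiSystem_pi ?_ ?_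
    · rintro _ ⟨C, hC, rfl⟩
      exact hbox fun k => hC k (Set.mem_univ k)
    · simpa only [Set.pi_univ] using hbox fun _ => MeasurableSet.univ
  filter_upwards [(withDensity_eq_iff hR.measurable.ennreal_ofReal.aemeasurable
    hR'.measurable.ennreal_ofReal.aemeasurable hfinite).1 hdensity] with y hy
  exact (ENNReal.ofReal_eq_ofReal_iff (hR.nonneg y) (hR'.nonneg y)).1 hy

theorem ae_eq [TopologicalSpace W] [T2Space W] [SecondCountableTopology W] [BorelSpace W]
    [SigmaFinite μ] [NullSingletonClass μ] [IsFiniteMeasure P]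
    (hR : IsCorrelationFunction μ P m R) (hR' : IsCorrelationFunction μ P m R') :
    R =ᵐ[Measure.pi fun _ => μ] R' := by
  let basis := TopologicalSpace.countableBasis W
  have hbasis : TopologicalSpace.IsTopologicalBasis basis :=
    TopologicalSpace.isBasis_countableBasis W
  have : Countable basis := (TopologicalSpace.countable_countableBasis W).to_subtype
  have hboxes : ∀ᵐ y ∂(Measure.pi fun _ : Fin m => μ), ∀ B : Fin m → basis,
      (Pairwise fun j k => Disjoint (B j : Set W) (B k)) →
        y ∈ Set.univ.pi (fun k => (B k : Set W)) → R y = R' y := by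
    simp only [ae_all_iff]
    intro B hdisj
    have hB (k : Fin m) : MeasurableSet (B k : Set W) := (hbasis.isOpen (B k).2).measurableSet
    exact (ae_restrict_iff' (MeasurableSet.univ_pi hB)).1 (hR.ae_eq_restrict hR' hB hdisj)
  filter_upwards [hboxes, ae_injective μ m] with y hy hinj
  obtain ⟨s, hs, hdisj⟩ := Pairwise.exists_mem_filter_of_disjoint (l := fun k => nhds (y k))
    fun i j hij => disjoint_nhds_nhds.2 (hinj.ne hij)
  choose b hb hyb hbs using fun k => hbasis.mem_nhds_iff.1 (hs k)
  exact hy (fun k => ⟨b k, hb k⟩) (fun i j hij => (hdisj hij).mono (hbs i) (hbs j))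
    fun k _ => hyb k

end IsCorrelationFunction

/-! ### The correlation functions of the circular ensemble -/

instance : NullSingletonClass haarCircle := by
  have : Nontrivial Circle := ⟨1, -1, fun h => by
    simpa [eq_neg_iff_add_eq_zero] using congrArg ((↑) : Circle → ℂ) h⟩
  have : (nhdsWithin (1 : Circle) {1}ᶜ).NeBot := PerfectSpace.not_isolated 1
  exact Measure.IsHaarMeasure.nullSingletonClass haarCircle

section AbsVandermonde

variable (β : ℕ)

theorem absVandermonde_nonneg {n : ℕ} (x : Fin n → Circle) : 0 ≤ absVandermonde β x :=
  Finset.prod_nonneg fun _ _ => Finset.prod_nonneg fun _ _ => pow_nonneg (norm_nonneg _) β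

theorem continuous_absVandermonde (n : ℕ) :
    Continuous fun x : Fin n → Circle => absVandermonde β x := by
  unfold absVandermonde
  fun_prop

theorem absVandermonde_sq {n : ℕ} (x : Fin n → Circle) :
    absVandermonde β x ^ 2 = ∏ k, ∏ j ∈ {k}ᶜ, ‖(x k : ℂ) - (x j : ℂ)‖ ^ β := by
  rw [← prod_prod_Iio_mul_eq_prod_prod_compl, absVandermonde, ← Finset.prod_pow]
  refine Finset.prod_congr rfl fun k _ => ?_
  rw [← Finset.prod_pow]
  refine Finset.prod_congr rfl fun j _ => ?_
  rw [norm_sub_rev (x j : ℂ), sq]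

theorem absVandermonde_comp_perm {n : ℕ} (τ : Equiv.Perm (Fin n)) (x : Fin n → Circle) :
    absVandermonde β (x ∘ τ) = absVandermonde β x := by
  rw [← sq_eq_sq₀ (absVandermonde_nonneg β _) (absVandermonde_nonneg β _), absVandermonde_sq,
    absVandermonde_sq, ← Equiv.prod_comp τ fun k => ∏ j ∈ {k}ᶜ, ‖(x k : ℂ) - (x j : ℂ)‖ ^ β]
  refine Finset.prod_congr rfl fun k _ => Finset.prod_equiv τ (fun j => ?_) fun j _ => rfl
  simp only [Finset.mem_compl, Finset.mem_singleton, EmbeddingLike.apply_eq_iff_eq]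

end AbsVandermonde

theorem jointDensity_nonneg (β M : ℕ) (x : Fin M → Circle) : 0 ≤ jointDensity β M x := by
  have : 0 ≤ partitionFunction β M :=
    mul_nonneg (by positivity) (integral_nonneg fun x => absVandermonde_nonneg β x)
  exact mul_nonneg (by positivity) (absVandermonde_nonneg β x)

theorem continuous_jointDensity (β M : ℕ) : Continuous (jointDensity β M) :=
  continuous_const.mul (continuous_absVandermonde β M)

instance (β M : ℕ) : IsFiniteMeasure (circularEnsemble β M) :=
  isFiniteMeasure_withDensity_ofReal (integrable_of_continuous (continuous_jointDensity β M)).2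

theorem isCorrelationFunction_correlation (β : ℕ) {m M : ℕ} (hm : m ≤ M) :
    IsCorrelationFunction haarCircle (circularEnsemble β M) m (correlation β hm) :=
  isCorrelationFunction_marginal haarCircle hm (continuous_jointDensity β M).measurable
    (jointDensity_nonneg β M)
    (fun τ x => by rw [jointDensity, jointDensity, absVandermonde_comp_perm])
    fun y => integrable_of_continuous ((continuous_jointDensity β M).comp (continuous_join hm y))

theorem absVandermonde_append (β : ℕ) {m n : ℕ} (y : Fin m → Circle) (x : Fin n → Circle) :
    absVandermonde β (Fin.append y x) = absVandermonde β y *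
      (absVandermonde β x * ∏ k, ∏ j, ‖(x k : ℂ) - (y j : ℂ)‖ ^ β) := by
  have hIio (f : Fin (m + n) → ℝ) (k : Fin n) : ∏ j ∈ Finset.Iio (Fin.natAdd m k), f j =
      (∏ j, f (Fin.castAdd n j)) * ∏ j ∈ Finset.Iio k, f (Fin.natAdd m j) := by
    have hlt (j : Fin m) : Fin.castAdd n j < Fin.natAdd m k :=
      j.isLt.trans_le (Nat.le_add_right m k)
    simp only [← Finset.filter_gt_eq_Iio, Finset.prod_filter, Fin.prod_univ_add,
      Fin.natAdd_lt_natAdd_iff, hlt, if_true]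
  simp only [absVandermonde, Fin.prod_univ_add, hIio, Fin.prod_Iio_castAdd, Fin.append_left,
    Fin.append_right, Finset.prod_mul_distrib]
  rw [mul_comm (∏ k, ∏ j, ‖(x k : ℂ) - (y j : ℂ)‖ ^ β)]

theorem absVandermonde_join (β : ℕ) {m M : ℕ} (hm : m ≤ M) (y : Fin m → Circle)
    (x : Fin (M - m) → Circle) :
    absVandermonde β (join hm y x) = absVandermonde β y *
      (absVandermonde β x * ∏ k, ∏ j, ‖(x k : ℂ) - (y j : ℂ)‖ ^ β) := by
  have hcast {n n' : ℕ} (h : n = n') (z : Fin n' → Circle) :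
      absVandermonde β (fun i => z (Fin.cast h i)) = absVandermonde β z := by
    subst h
    rfl
  exact (hcast (Nat.add_sub_of_le hm).symm _).trans (absVandermonde_append β y x)

theorem factorial_mul_partitionFunction (c M : ℕ) :
    (M.factorial : ℝ) * partitionFunction (2 * c) M =
      (Nat.multinomial (Finset.univ : Finset (Fin M)) fun _ => c : ℝ) := by
  rw [partitionFunction, integral_absVandermonde, one_div,
    mul_inv_cancel_left₀ (Nat.cast_ne_zero.2 (Nat.factorial_ne_zero M))]

theorem correlation_eq (c : ℕ) {m M : ℕ} (hm : m ≤ M) (y : Fin m → Circle) :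
    correlation (2 * c) hm y = (M.factorial : ℝ) / ((M - m).factorial : ℝ) *
      ((Nat.multinomial (Finset.univ : Finset (Fin M)) fun _ => c : ℝ)⁻¹ *
        (absVandermonde (2 * c) y * ∫ x : Fin (M - m) → Circle, absVandermonde (2 * c) x *
          ∏ k, ∏ j, ‖(x k : ℂ) - (y j : ℂ)‖ ^ (2 * c) ∂(haarTorus (M - m)))) := by
  rw [correlation]
  change _ * ∫ x, jointDensity (2 * c) M (join hm y x) ∂(haarTorus (M - m)) = _
  simp only [jointDensity, factorial_mul_partitionFunction, absVandermonde_join]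
  rw [integral_const_mul, integral_const_mul, one_div]

theorem correlation_eq_hyperpfaffian {L M m : ℕ} (hL : Even L) (hL0 : 0 < L) (hm : m ≤ M)
    (y : Fin m → Circle) :
    (correlation (L ^ 2) hm y : ℂ) =
      (M.factorial : ℂ) *
        (Nat.multinomial (Finset.univ : Finset (Fin M)) (fun _ => L ^ 2 / 2) : ℂ)⁻¹ *
        (∏ k, ∏ j ∈ Finset.Iio k, ((‖(y k : ℂ) - (y j : ℂ)‖ : ℝ) : ℂ) ^ (L ^ 2)) *
        (∏ n, (y n : ℂ) ^ (-((L ^ 2 * (M - m) / 2 : ℕ) : ℤ))) *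
        hyperpfaffian L (M - m) (gammaVec L (M - m) y) := by
  obtain ⟨c, -, hLc⟩ := exists_even_sq_eq_two_mul hL
  have hhalf : L ^ 2 / 2 = c := by omega
  have hintegral := integral_absVandermonde_mul_prod (M - m) hL hL0 y
  rw [hLc, correlation_eq, ← hLc, hhalf]
  push_cast
  rw [← integral_complex_ofReal]
  push_cast
  rw [hintegral, hyperpfaffian, hodgeStarTop_smul, absVandermonde]
  push_cast
  ring

end HyperPf

end

theorem mainTheorem2 (L M m : ℕ) (hL : Even L) (hL0 : 0 < L) (hm : 1 ≤ m) (hmM : m ≤ M) :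
    -- the marginal-density version of `R_m` is given everywhere by the hyperpfaffian formula
    (∀ y : Fin m → Circle,
      (HyperPf.correlation (L ^ 2) hmM y : ℂ) =
        (M.factorial : ℂ) *
          (Nat.multinomial (Finset.univ : Finset (Fin M)) (fun _ => L ^ 2 / 2) : ℂ)⁻¹ *
          (∏ k, ∏ j ∈ Finset.Iio k, ((‖(y k : ℂ) - (y j : ℂ)‖ : ℝ) : ℂ) ^ (L ^ 2)) *
          (∏ n, (y n : ℂ) ^ (-((L ^ 2 * (M - m) / 2 : ℕ) : ℤ))) *
          HyperPf.hyperpfaffian L (M - m) (HyperPf.gammaVec L (M - m) y)) ∧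
    -- it is an `m`-th correlation function of the ensemble, and the only one up to null sets
    HyperPf.IsCorrelationFunction HyperPf.haarCircle (HyperPf.circularEnsemble (L ^ 2) M) m
        (HyperPf.correlation (L ^ 2) hmM) ∧
    (∀ R : (Fin m → Circle) → ℝ,
      HyperPf.IsCorrelationFunction HyperPf.haarCircle (HyperPf.circularEnsemble (L ^ 2) M) m R →
      ∀ᵐ y ∂(MeasureTheory.Measure.pi fun _ : Fin m => HyperPf.haarCircle),
        R y = HyperPf.correlation (L ^ 2) hmM y) := by
  have hcorrelation := HyperPf.isCorrelationFunction_correlation (L ^ 2) hmM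
  exact ⟨HyperPf.correlation_eq_hyperpfaffian hL hL0 hmM, hcorrelation,
    fun R hR => hR.ae_eq hcorrelation⟩
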